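/- Let $R$ be an arbitrary ring and work in the category of left $R$-modules. An ideal is an additive subfunctor of $\operatorname{Hom}_R$, i.e. a class of $R$-homomorphisms that contains all zero homomorphisms, is closed under sums of homomorphisms with the same domain and codomain, and is closed under composition on either side with arbitrary $R$-homomorphisms. For an ideal $\mathcal I$ let $\mathcal I^\perp$ be the class of all homomorphisms $j:U\to V$ such that for every $i:X\to Y$ in $\mathcal I$ the map $\operatorname{Ext}^1_R(i,j):\operatorname{Ext}^1_R(Y,U)\to\operatorname{Ext}^1_R(X,V)$ is zero. Let $\mathcal I$ be an ideal generated by a set of homomorphisms, i.e. there is a family of homomorphisms $(f_k:M_k\to N_k)_{k\in K}$ indexed by a set $K$ such that $\mathcal I$ is the smallest ideal containing every $f_k$. Then there is an assignment $\mu\mapsto\kappa(\mu)$ from cardinals to cardinals, depending only on $\mathcal I$, such that for all $R$-modules $U,V$ and every $g:U\to V$ in $\mathcal I^\perp$ there are a submodule $V'\subseteq V$ and a homomorphism $g':U\to V'$ such that $g$ is the composition of $g'$ with the inclusion $V'\hookrightarrow V$, $g'$ is in $\mathcal I^\perp$, and $|V'|\le\kappa(|U|)$. -/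

import Mathlib

open CategoryTheory

universe u v w

/-- An ideal of a preadditive category: an additive subfunctor of `Hom`, that is, a class of
morphisms that contains the zero morphisms, is closed under the sum of parallel morphisms, and
is closed under composition with arbitrary morphisms on both sides. (Closure under negation
follows by composing with `-𝟙`.) -/
@[ext]
structure HomIdeal (C : Type u) [Category.{v} C] [Preadditive C] where
  /-- the class of morphisms that belong to the ideal -/
  mor : MorphismProperty C
  zero_mem : ∀ X Y : C, mor (0 : X ⟶ Y)
  add_mem : ∀ {X Y : C} (f g : X ⟶ Y), mor f → mor g → mor (f + g)
  comp_mem : ∀ {W X Y Z : C} (h : W ⟶ X) (g : X ⟶ Y) (f : Y ⟶ Z), mor g → mor (h ≫ g ≫ f)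

namespace HomIdeal

/-- The ideal generated by a family of morphisms: the smallest ideal that contains all of them,
obtained as the intersection of all such ideals. -/
def span {C : Type u} [Category.{v} C] [Preadditive C] {K : Type w} {M N : K → C}
    (f : ∀ k, M k ⟶ N k) : HomIdeal C where
  mor := fun _ _ φ => ∀ J : HomIdeal C, (∀ k, J.mor (f k)) → J.mor φ
  zero_mem := fun X Y J _ => J.zero_mem X Y
  add_mem := fun a b ha hb J hJ => J.add_mem a b (ha J hJ) (hb J hJ)
  comp_mem := fun h g f hg J hJ => J.comp_mem h g f (hg J hJ)

/-- An ideal is generated by a set if it is generated by a family of morphisms whose index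
set `K` is small with respect to the universe in which the morphisms live. -/
def IsGeneratedBySet {C : Type u} [Category.{v} C] [Preadditive C] (I : HomIdeal C) : Prop :=
  ∃ (K : Type v) (M N : K → C) (f : ∀ k, M k ⟶ N k), I = span f

/-- The class `I^⊥` of all morphisms `j : U ⟶ V` such that `Ext¹(i, j) = 0` for every `i` in `I`.
For `i : X ⟶ Y` the map `Ext¹(i, j) : Ext¹(Y, U) → Ext¹(X, V)` is `ξ ↦ j ∘ ξ ∘ i`. -/
def perp {C : Type u} [Category.{v} C] [Abelian C] [HasExt.{w} C] (I : HomIdeal C) :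
    MorphismProperty C :=
  fun U _ j => ∀ ⦃X Y : C⦄ (i : X ⟶ Y), I.mor i → ∀ ξ : Abelian.Ext Y U 1,
    (Abelian.Ext.mk₀ i).comp (ξ.comp (Abelian.Ext.mk₀ j) (add_zero 1)) (zero_add 1) = 0

end HomIdeal

namespace HomIdeal

section Abelian

open Abelian

variable {C : Type u} [Category.{v} C] [Abelian C] [HasExt.{w} C]

/-! For fixed `j`, the `i` with `Ext¹(i, j) = 0` form an ideal, so only the generators `f k` need
testing. Given a projective presentation `0 → L k → Q k → M k → 0`, this means that certain maps `a
≫ g`, with `a : L k ⟶ U`, extend to `Q k`. Let `V'` be spanned by the image of `g` and the values of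
one chosen extension for each extendable `a ≫ g`: every extension problem solvable for `g` stays
solvable for `g'`, and the generators are counted by `|U|` and fixed data. -/

/-- The ideal of all morphisms `i` such that `Ext¹(i, j) = 0` for a fixed morphism `j`. -/
def extAnnihilator {U V : C} (j : U ⟶ V) : HomIdeal C where
  mor := fun _ Y i => ∀ ξ : Ext Y U 1,
    (Ext.mk₀ i).comp (ξ.comp (Ext.mk₀ j) (add_zero 1)) (zero_add 1) = 0
  zero_mem := fun X Y ξ => by simp
  add_mem := fun f g hf hg ξ => by rw [Ext.mk₀_add, Ext.add_comp, hf, hg, add_zero]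
  comp_mem := fun h g f hg ξ => by
    have := hg ((Ext.mk₀ f).comp ξ (zero_add 1))
    rw [← Ext.mk₀_comp_mk₀_assoc, ← Ext.mk₀_comp_mk₀_assoc,
      ← Ext.comp_assoc_of_third_deg_zero (Ext.mk₀ f), this, Ext.comp_zero]

theorem perp_span_iff {K : Type*} {M N : K → C} (f : ∀ k, M k ⟶ N k) {U V : C} (j : U ⟶ V) :
    (span f).perp j ↔ ∀ k, (extAnnihilator j).mor (f k) :=
  ⟨fun h k => h (f k) fun _ hJ => hJ k, fun h _ _ _ hi => hi (extAnnihilator j) h⟩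

/-- A connecting class `δ(a)` is killed by `g` exactly when `a ≫ g` extends along `S.f`. -/
theorem extClass_comp_mk₀_eq_zero_iff {S : ShortComplex C} (hS : S.ShortExact) {V : C}
    (c : S.X₁ ⟶ V) :
    hS.extClass.comp (Ext.mk₀ c) (add_zero 1) = 0 ↔ ∃ b : S.X₂ ⟶ V, S.f ≫ b = c := by
  constructor
  · intro h
    obtain ⟨x, hx⟩ := Ext.contravariant_sequence_exact₁ hS V (Ext.mk₀ c) (add_zero 1) h
    obtain ⟨b, rfl⟩ := (Ext.mk₀_bijective _ _).2 x
    rw [Ext.mk₀_comp_mk₀] at hx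
    exact ⟨b, (Ext.mk₀_bijective _ _).1 hx⟩
  · rintro ⟨b, rfl⟩
    rw [← Ext.mk₀_comp_mk₀, hS.extClass_comp_assoc]

theorem exists_extClass_comp_mk₀_eq {S : ShortComplex C} (hS : S.ShortExact) [Projective S.X₂]
    {U : C} (η : Ext S.X₃ U 1) :
    ∃ a : S.X₁ ⟶ U, hS.extClass.comp (Ext.mk₀ a) (add_zero 1) = η := by
  obtain ⟨x, hx⟩ := Ext.contravariant_sequence_exact₃ hS U η (Ext.eq_zero_of_projective _)
    (add_zero 1)
  obtain ⟨a, rfl⟩ := (Ext.mk₀_bijective _ _).2 x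
  exact ⟨a, hx⟩

/-- `Ext¹(i, -)` kills `g'` as soon as it kills `g` and, for a projective presentation `S` of the
domain of `i`, every `a ≫ g'` extends along `S.f` whenever `a ≫ g` does. -/
theorem extAnnihilator_mor_of_extensions {S : ShortComplex C} (hS : S.ShortExact)
    [Projective S.X₂] {Y U V W : C} {i : S.X₃ ⟶ Y} {g : U ⟶ V} {g' : U ⟶ W}
    (hi : (extAnnihilator g).mor i)
    (h : ∀ a : S.X₁ ⟶ U, (∃ b, S.f ≫ b = a ≫ g) → ∃ b, S.f ≫ b = a ≫ g') :
    (extAnnihilator g').mor i := by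
  intro ξ
  obtain ⟨a, ha⟩ := exists_extClass_comp_mk₀_eq hS ((Ext.mk₀ i).comp ξ (zero_add 1))
  have key : ∀ {Z : C} (q : U ⟶ Z),
      (Ext.mk₀ i).comp (ξ.comp (Ext.mk₀ q) (add_zero 1)) (zero_add 1) = 0 ↔
        -- One `a` serves every `q`: it represents the pullback of `ξ` along `i`.
        ∃ b, S.f ≫ b = a ≫ q := by
    intro Z q
    rw [← extClass_comp_mk₀_eq_zero_iff hS, ← Ext.mk₀_comp_mk₀,
      ← Ext.comp_assoc_of_third_deg_zero (Ext.mk₀ i), ← ha,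
      Ext.comp_assoc_of_third_deg_zero]
  exact (key g').2 (h a ((key g).1 (hi ξ)))

end Abelian

end HomIdeal

/-- The bound depends only on `T` and `R`; `Shrink` keeps it in universe `v`. -/
theorem Submodule.mk_span_range_le {R : Type u} [Ring R] [Small.{v} R] {V T : Type v}
    [AddCommGroup V] [Module R V] (s : T → V) :
    Cardinal.mk (Submodule.span R (Set.range s)) ≤ Cardinal.mk (T →₀ Shrink.{v} R) := by
  let φ : (T →₀ Shrink.{v} R) → Submodule.span R (Set.range s) := fun c =>
    ⟨Finsupp.linearCombination R s (c.mapRange (equivShrink R).symm (by simp)), by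
      rw [← Finsupp.range_linearCombination]
      exact ⟨_, rfl⟩⟩
  refine Cardinal.mk_le_of_surjective (f := φ) ?_
  rintro ⟨x, hx⟩
  rw [← Finsupp.range_linearCombination] at hx
  obtain ⟨c, rfl⟩ := hx
  refine ⟨c.mapRange (equivShrink R) rfl, Subtype.ext ?_⟩
  refine congrArg (Finsupp.linearCombination R s) ?_
  ext t
  simp

theorem mainTheorem2 {R : Type u} [Ring R] [Small.{v} R] (I : HomIdeal (ModuleCat.{v} R))
    (hI : I.IsGeneratedBySet) :
    ∃ κ : Cardinal.{v} → Cardinal.{v}, ∀ (U V : ModuleCat.{v} R) (g : U ⟶ V), I.perp g →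
      ∃ (V' : Submodule R V) (g' : U ⟶ ModuleCat.of R V'),
        g' ≫ ModuleCat.ofHom V'.subtype = g ∧ I.perp g' ∧
          Cardinal.mk V' ≤ κ (Cardinal.mk U) := by
  classical
  obtain ⟨K, M, N, f, rfl⟩ := hI
  have hpres : ∀ k, ∃ (L Q : ModuleCat.{v} R) (ι : L ⟶ Q) (π : Q ⟶ M k) (w : ι ≫ π = 0),
      Projective Q ∧ (ShortComplex.mk ι π w).ShortExact := by
    intro k
    obtain ⟨P⟩ := EnoughProjectives.presentation (M k)
    exact ⟨_, P.p, Limits.kernel.ι P.f, P.f, Limits.kernel.condition P.f, P.projective,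
      { exact := ShortComplex.exact_kernel P.f
        mono_f := inferInstance
        epi_g := P.epi }⟩
  choose L Q ι π w hQ hS using hpres
  -- Indexes the generators of `V'`: elements of `U`, and values at `q : Q k` of the chosen
  -- extensions.
  let T : Type v → Type v := fun X => X ⊕ (Σ k, (L k → X) × Q k)
  refine ⟨fun μ => Cardinal.mk (T μ.out →₀ Shrink.{v} R), fun U V g hg => ?_⟩
  obtain ⟨e⟩ : Nonempty ((Cardinal.mk U).out ≃ U) := Cardinal.eq.1 (Cardinal.mk_out _)
  -- Since `(Cardinal.mk U).out` is a bare set, `c` ranges over all functions; each matches at most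
  -- one linear `a`, and `b` is 0 if no extendable `a ≫ g` arises.
  have hext : ∀ k (c : L k → (Cardinal.mk U).out), ∃ b : Q k ⟶ V, ∀ a : L k ⟶ U,
      (∀ x, e (c x) = a x) → (∃ b', ι k ≫ b' = a ≫ g) → ι k ≫ b = a ≫ g := by
    intro k c
    by_cases h : ∃ a : L k ⟶ U, (∀ x, e (c x) = a x) ∧ ∃ b', ι k ≫ b' = a ≫ g
    · obtain ⟨a, ha, b, hb⟩ := h
      refine ⟨b, fun a' ha' _ => ?_⟩
      have : a' = a := by
        ext x
        rw [← ha', ← ha]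
      rw [this, hb]
    · exact ⟨0, fun a ha hb => absurd ⟨a, ha, hb⟩ h⟩
  choose b hb using hext
  let s : T (Cardinal.mk U).out → V := Sum.elim (fun x => g (e x)) (fun p => b p.1 p.2.1 p.2.2)
  let V' : Submodule R V := Submodule.span R (Set.range s)
  have hgV : ∀ x, g.hom x ∈ V' := fun x =>
    Submodule.subset_span ⟨Sum.inl (e.symm x), by simp [s]⟩
  refine ⟨V', ModuleCat.ofHom (g.hom.codRestrict V' hgV), rfl, ?_, Submodule.mk_span_range_le s⟩
  rw [HomIdeal.perp_span_iff] at hg ⊢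
  intro k
  have := hQ k
  refine HomIdeal.extAnnihilator_mor_of_extensions (hS k) (hg k) fun a ha => ?_
  let c : L k → (Cardinal.mk U).out := fun x => e.symm (a x)
  have hbV : ∀ q, (b k c).hom q ∈ V' := fun q => Submodule.subset_span ⟨Sum.inr ⟨k, c, q⟩, rfl⟩
  refine ⟨ModuleCat.ofHom ((b k c).hom.codRestrict V' hbV), ?_⟩
  exact ModuleCat.hom_ext <| LinearMap.ext fun x => Subtype.ext <|
    ConcreteCategory.congr_hom (hb k c a (fun x => by simp [c]) ha) x
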